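/- Let $\lambda$ be a regular uncountable cardinal, let $1 \le n < \omega$, and let $\mu = \sigma(\lambda,n)$, where $\sigma(\lambda,1) := \lambda$ and $\sigma(\lambda,m+1) := \bigl(2^{<\sigma(\lambda,m)}\bigr)^+$ for $m \ge 1$. Let $\chi$ be an infinite cardinal and let $\mathbb{P}$ be the forcing to add $\chi$-many Cohen reals, i.e. the set of finite partial functions from $\chi$ to $2$, where $p \le q$ iff $p$ extends $q$. Then for every sequence $\langle p_a \mid a \in [\mu]^n\rangle$ of conditions in $\mathbb{P}$ there is a set $H \subseteq \mu$ with $|H| = \lambda$ such that, for all $a, b \in [H]^n$, if $a$ and $b$ are aligned, then $p_a$ and $p_b$ are compatible, i.e. there is $r \in \mathbb{P}$ with $r \le p_a$ and $r \le p_b$. Here $[X]^n$ is the set of $n$-element subsets of $X$, and sets of ordinals $a, b$ are called aligned if $\mathrm{otp}(a) = \mathrm{otp}(b)$ and $\mathrm{otp}(a \cap \gamma) = \mathrm{otp}(b \cap \gamma)$ for all $\gamma \in a \cap b$. -/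

import Mathlib

universe u

namespace HigherKnaster

/-- The order type of a set of ordinals.  (A set of ordinals of `Ordinal.{u}` is a subtype of
`Ordinal.{u} : Type (u + 1)`, so its order type lives one universe up.) -/
noncomputable def otp (a : Set Ordinal.{u}) : Ordinal.{u + 1} :=
  Ordinal.type (fun x y : a => x < y)

/-- Two sets of ordinals are aligned if they have the same order type and every common element
occupies the same relative position in both. -/
def Aligned (a b : Set Ordinal.{u}) : Prop :=
  otp a = otp b ∧ ∀ γ ∈ a ∩ b, otp (a ∩ Set.Iio γ) = otp (b ∩ Set.Iio γ)

/-- `[X]^n`: the set of all `n`-element subsets of a set `X` of ordinals, `n` a natural number. -/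
def nSubsets (X : Set Ordinal.{u}) (n : ℕ) : Set (Finset Ordinal.{u}) :=
  {a | (a : Set Ordinal.{u}) ⊆ X ∧ a.card = n}

/-- `σ(lam, 1) = lam` and `σ(lam, n + 1) = (2^{<σ(lam, n)})⁺` for `n ≥ 1`.
The value at `n = 0` is a placeholder, `σ(lam, n)` being meaningful for `n ≥ 1` only. -/
noncomputable def sigma (lam : Cardinal.{u}) : ℕ → Cardinal.{u}
  | 0 => lam
  | 1 => lam
  | n + 2 => Order.succ (Cardinal.powerlt 2 (sigma lam (n + 1)))

/-- The forcing `Fn(I, 2)`: its conditions are the finite partial functions from `I` to `2`. -/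
@[ext]
structure Cohen (I : Type*) where
  toPFun : I →. Fin 2
  finite_dom : toPFun.Dom.Finite

/-- A condition `p` is stronger than `q` (written `p ≤ q`) if `p` extends `q` as a function. -/
instance (I : Type*) : PartialOrder (Cohen I) where
  le p q := ∀ i, ∀ v ∈ q.toPFun i, v ∈ p.toPFun i
  le_refl _ _ _ h := h
  le_trans _ _ _ h₁ h₂ i v h := h₁ i v (h₂ i v h)
  le_antisymm _ _ h₁ h₂ := Cohen.ext (PFun.ext fun i v => ⟨h₂ i v, h₁ i v⟩)

/-- Two conditions of a forcing notion are compatible if they have a common extension. -/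
def Compatible {P : Type*} [PartialOrder P] (p q : P) : Prop :=
  ∃ r : P, r ≤ p ∧ r ≤ q

end HigherKnaster

namespace HigherKnaster

open Cardinal Set

/-! The proof is an induction on `n` from a regular `κ` to `θ = (2^{<κ})⁺`, in the style of
Erdős–Rado. The invariant `HasRootedSubsystems` yields, besides a subsystem of size `lam`, roots `r
a` for shorter `a`: whatever `r (a ∪ {x})` has on prescribed finite sets of coordinates indexed
below `x` already lies in `r a`. For `n = 1` this is the Δ-system lemma.

For the step, `powerlt_power_le` gives `exists_reflecting`: a point `δ < θ` whose type over fewer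
than `κ` smaller points is always realized below `δ`. Hence some `κ`-sequence below `δ` has members
that all imitate `δ` over their predecessors (`exists_end_uniform`). The induction hypothesis for
the conditions `p (a ∪ {δ})` thins this sequence, and its roots, cut down to the coordinates
captured below `δ`, are the new roots.

To see that two aligned pieces are consistent, compare their tops. If these differ, a shared
coordinate is captured below the larger top, so that piece may be replaced by its root with the top
removed; repeating this leads to the induction hypothesis. If two full conditions share their top,
consistency transfers from `δ`. Alignment ensures that a full condition never meets a shorter root
with the same top. -/

/-! ### Regular cardinals and transfinite recursion. -/

theorem exists_forall_lt_of_mk_lt {c : Cardinal.{u}} (hc : c.IsRegular) (X : Set c.ord.ToType)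
    (hX : #X < c) : ∃ b, ∀ x ∈ X, x < b := by
  by_contra h
  have hcof : IsCofinal X := fun b => by
    by_contra hb
    exact h ⟨b, fun x hx => not_le.1 fun hbx => hb ⟨x, hx, hbx⟩⟩
  have := Order.cof_le hcof
  rw [Ordinal.cof_toType, hc.cof_ord] at this
  exact absurd hX this.not_gt

theorem exists_mk_Iio_eq {c d : Cardinal.{u}} (h : d < c) : ∃ x : c.ord.ToType, #(Iio x) = d := by
  obtain ⟨x, hx⟩ := Ordinal.typein_surj (α := c.ord.ToType) (· < ·) (o := d.ord) (by simpa using h)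
  refine ⟨x, ?_⟩
  have := congrArg Ordinal.card hx
  rwa [card_ord] at this

theorem mk_Iio_toType_lt {c : Cardinal.{u}} (x : c.ord.ToType) : #(Iio x) < c := by
  simpa using mk_Iio_lt x

/-- Transfinite recursion along a regular cardinal, in relational form. -/
theorem exists_recursion {κ : Cardinal.{u}} {W : Type u} (P : W → Prop) (Φ : Set W → W → Prop)
    (h : ∀ X : Set W, #X < κ → (∀ x ∈ X, P x) → ∃ b, P b ∧ Φ X b) :
    ∃ α : κ.ord.ToType → W, ∀ ξ, P (α ξ) ∧ Φ (α '' Iio ξ) (α ξ) := by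
  classical
  rcases isEmpty_or_nonempty κ.ord.ToType with hK | hK
  · exact ⟨fun x => (hK.false x).elim, fun x => (hK.false x).elim⟩
  have hW : Nonempty W := by
    obtain ⟨b, -⟩ := h ∅ (by
      rw [mk_eq_zero]
      rw [pos_iff_ne_zero]
      rintro rfl
      simp at hK) (by simp)
    exact ⟨b⟩
  let step : Set W → W := fun X => if hX : ∃ b, P b ∧ Φ X b then hX.choose else hW.some
  let α : κ.ord.ToType → W := WellFoundedLT.fix
    (motive := fun _ => W) fun ξ rec => step (range fun ζ : Iio ξ => rec ζ.1 ζ.2)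
  have hα : ∀ ξ, α ξ = step (α '' Iio ξ) := fun ξ => by
    have : α ξ = step (range fun ζ : Iio ξ => α ζ.1) := WellFoundedLT.fix_eq
      (motive := fun _ => W) (fun ξ rec => step (range fun ζ : Iio ξ => rec ζ.1 ζ.2)) ξ
    rw [this, image_eq_range]
  refine ⟨α, fun ξ => ?_⟩
  induction ξ using WellFoundedLT.induction with
  | ind ξ ih =>
    have hex : ∃ b, P b ∧ Φ (α '' Iio ξ) b := h _
      (mk_image_le.trans_lt (mk_Iio_toType_lt ξ)) (by rintro _ ⟨ζ, hζ, rfl⟩; exact (ih ζ hζ).1)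
    have : α ξ = hex.choose := (hα ξ).trans (dif_pos hex)
    rw [this]
    exact hex.choose_spec

/-! ### Arithmetic of `2 ^< κ`. -/

theorem le_two_powerlt (κ : Cardinal.{u}) : κ ≤ 2 ^< κ := by
  by_contra h
  rw [not_le] at h
  exact absurd (le_powerlt 2 h) (cantor _).not_ge

/-- There are at least `2 ^< κ` bounded subsets of `κ`. By regularity, `ρ` of them have a common
bound `ξ`, so such sequences are counted by `κ` many powers `2 ^ (#(Iio ξ) * ρ)`. -/
theorem powerlt_power_le {κ ρ : Cardinal.{u}} (hκ : κ.IsRegular) (hρ : ρ < κ) :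
    (2 ^< κ : Cardinal.{u}) ^ ρ ≤ 2 ^< κ := by
  let K := κ.ord.ToType
  let Bd := {S : Set K // ∃ ξ, S ⊆ Iio ξ}
  have hν : ℵ₀ ≤ (2 ^< κ : Cardinal.{u}) := hκ.aleph0_le.trans (le_two_powerlt κ)
  have h1 : (2 ^< κ : Cardinal.{u}) ≤ #Bd := by
    rw [powerlt_le]
    intro τ hτ
    obtain ⟨ξ, hξ⟩ := exists_mk_Iio_eq hτ
    rw [← hξ, ← mk_set]
    refine mk_le_of_injective (f := fun S : Set (Iio ξ) => (⟨(↑) '' S, ξ, by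
      rintro _ ⟨y, -, rfl⟩; exact y.2⟩ : Bd)) fun S T hST => ?_
    exact Subtype.val_injective.image_injective (congrArg Subtype.val hST)
  induction ρ using Cardinal.inductionOn with
  | _ R =>
  have h2 : #(R → Bd) ≤ #(Σ ξ : K, (R → Set (Iio ξ))) := by
    refine mk_le_of_surjective (f := fun x r => (⟨(↑) '' x.2 r, x.1, by
      rintro _ ⟨y, -, rfl⟩; exact y.2⟩ : Bd)) fun f => ?_
    choose b hb using fun r => (f r).2
    obtain ⟨ξ, hξ⟩ := exists_forall_lt_of_mk_lt hκ (range b) (mk_range_le.trans_lt hρ)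
    refine ⟨⟨ξ, fun r => (↑) ⁻¹' (f r).1⟩, funext fun r => Subtype.ext ?_⟩
    change Subtype.val '' (Subtype.val ⁻¹' (f r).1) = (f r).1
    rw [Subtype.image_preimage_coe, inter_eq_right]
    exact fun y hy => (hb r hy).trans (hξ _ ⟨r, rfl⟩)
  calc (2 ^< κ : Cardinal.{u}) ^ #R ≤ #Bd ^ #R := power_le_power_right h1
    _ = #(R → Bd) := rfl
    _ ≤ _ := h2
    _ = sum fun ξ : K => #(R → Set (Iio ξ)) := mk_sigma _
    _ ≤ sum fun _ : K => (2 ^< κ : Cardinal.{u}) := by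
      refine sum_le_sum _ _ fun ξ => ?_
      rw [← power_def, mk_set, ← power_mul]
      exact le_powerlt _ (mul_lt_of_lt hκ.aleph0_le (mk_Iio_toType_lt ξ) hρ)
    _ = κ * 2 ^< κ := by rw [sum_const']; simp [K]
    _ ≤ 2 ^< κ * 2 ^< κ := mul_le_mul_left (le_two_powerlt κ) _
    _ = 2 ^< κ := mul_eq_self hν

theorem mk_subsets_lt_le {κ : Cardinal.{u}} (hκ : κ.IsRegular) {A : Type u} (s : Set A)
    (hs : #s ≤ 2 ^< κ) : #{t : Set A // t ⊆ s ∧ #t < κ} ≤ 2 ^< κ := by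
  have hν : ℵ₀ ≤ (2 ^< κ : Cardinal.{u}) := hκ.aleph0_le.trans (le_two_powerlt κ)
  let K := κ.ord.ToType
  have hsub : {t : Set A | t ⊆ s ∧ #t < κ} ⊆ ⋃ ξ : K, {t : Set A | t ⊆ s ∧ #t ≤ #(Iio ξ)} := by
    rintro t ⟨ht, htκ⟩
    obtain ⟨ξ, hξ⟩ := exists_mk_Iio_eq htκ
    exact mem_iUnion.2 ⟨ξ, ht, hξ.ge⟩
  calc #{t : Set A | t ⊆ s ∧ #t < κ} ≤ _ := mk_le_mk_of_subset hsub
    _ ≤ sum fun ξ : K => #{t : Set A | t ⊆ s ∧ #t ≤ #(Iio ξ)} := mk_iUnion_le_sum_mk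
    _ ≤ sum fun _ : K => (2 ^< κ : Cardinal.{u}) := by
      refine sum_le_sum _ _ fun ξ => (mk_bounded_subset_le s _).trans ?_
      exact (power_le_power_right (max_le hs hν)).trans
        (powerlt_power_le hκ (mk_Iio_toType_lt ξ))
    _ = κ * 2 ^< κ := by rw [sum_const']; simp [K]
    _ ≤ 2 ^< κ * 2 ^< κ := mul_le_mul_left (le_two_powerlt κ) _
    _ = 2 ^< κ := mul_eq_self hν

/-! ### Reflection and end-uniform sequences. -/

/-- Below the successor of `2 ^< κ` there is a point whose type over each small set of smaller
points is realized by a smaller point. -/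
theorem exists_reflecting {κ θ : Cardinal.{u}} (hκ : κ.IsRegular)
    (hθ : θ = Order.succ (2 ^< κ)) {τ : Type u} (T : Set θ.ord.ToType → θ.ord.ToType → τ)
    (hT : ∀ X : Set θ.ord.ToType, #X < κ → #(range (T X)) ≤ 2 ^< κ) :
    ∃ δ, ∀ X : Set θ.ord.ToType, (∀ x ∈ X, x < δ) → #X < κ →
      ∃ β < δ, (∀ x ∈ X, x < β) ∧ T X β = T X δ := by
  classical
  set ν : Cardinal.{u} := 2 ^< κ
  have hν : ℵ₀ ≤ ν := hκ.aleph0_le.trans (le_two_powerlt κ)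
  have hreg : θ.IsRegular := hθ ▸ isRegular_succ hν
  have hκν : κ < θ := hθ ▸ Order.lt_succ_iff.2 (le_two_powerlt κ)
  have hnext : ∀ (X : Set θ.ord.ToType) (t : τ), ∃ β,
      (∃ β, (∀ x ∈ X, x < β) ∧ T X β = t) → (∀ x ∈ X, x < β) ∧ T X β = t := by
    intro X t
    by_cases h : ∃ β, (∀ x ∈ X, x < β) ∧ T X β = t
    · exact ⟨h.choose, fun _ => h.choose_spec⟩
    · obtain ⟨b, -⟩ := exists_forall_lt_of_mk_lt hreg ∅ (by simp [hreg.pos])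
      exact ⟨b, fun h' => (h h').elim⟩
  choose next hnext using hnext
  have hG : ∀ η : θ.ord.ToType, ∃ γ, ∀ X, X ⊆ Iio η → #X < κ → ∀ β,
      next X (T X β) < γ := by
    intro η
    -- At most `2 ^< κ` small sets `X` lie below `η`, each with at most `2 ^< κ` types, so the
    -- chosen realizers are bounded in `θ`.
    let E : Set θ.ord.ToType :=
      ⋃ X : {X : Set θ.ord.ToType // X ⊆ Iio η ∧ #X < κ}, next X.1 '' range (T X.1)
    obtain ⟨γ, hγ⟩ := exists_forall_lt_of_mk_lt hreg E (by
      refine lt_of_le_of_lt ?_ ((Order.lt_succ ν).trans_eq hθ.symm)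
      calc #E ≤ sum fun X : {X : Set θ.ord.ToType // X ⊆ Iio η ∧ #X < κ} =>
            #(next X.1 '' range (T X.1)) := mk_iUnion_le_sum_mk
        _ ≤ sum fun _ : {X : Set θ.ord.ToType // X ⊆ Iio η ∧ #X < κ} => ν :=
          sum_le_sum _ _ fun X => mk_image_le.trans (hT X.1 X.2.2)
        _ = #{X : Set θ.ord.ToType // X ⊆ Iio η ∧ #X < κ} * ν := by
          rw [sum_const']
        _ ≤ ν * ν := mul_le_mul_left (mk_subsets_lt_le hκ _
          (Order.lt_succ_iff.1 ((mk_Iio_toType_lt η).trans_eq hθ))) _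
        _ = ν := mul_eq_self hν)
    exact ⟨γ, fun X hX hXκ β => hγ _ (mem_iUnion.2 ⟨⟨X, hX, hXκ⟩, _, ⟨β, rfl⟩, rfl⟩)⟩
  choose G hG using hG
  obtain ⟨α, hα⟩ := exists_recursion (κ := κ) (fun _ => True)
    (fun X b => ∀ x ∈ X, x < b ∧ G x < b) (by
      intro X hX _
      obtain ⟨b, hb⟩ := exists_forall_lt_of_mk_lt hreg (X ∪ G '' X) (by
        refine (mk_union_le _ _).trans_lt (add_lt_of_lt hreg.aleph0_le (hX.trans hκν) ?_)
        exact mk_image_le.trans_lt (hX.trans hκν))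
      exact ⟨b, trivial, fun x hx => ⟨hb x (.inl hx), hb _ (.inr ⟨x, hx, rfl⟩)⟩⟩)
  have hα' : ∀ ζ ξ, ζ < ξ → α ζ < α ξ ∧ G (α ζ) < α ξ := fun ζ ξ h => (hα ξ).2 _ ⟨ζ, h, rfl⟩
  have hbd : ∃ δ, ∀ ξ, α ξ < δ := by
    obtain ⟨b, hb⟩ := exists_forall_lt_of_mk_lt hreg (range α) (mk_range_le.trans_lt (by simpa using hκν))
    exact ⟨b, fun ξ => hb _ ⟨ξ, rfl⟩⟩
  -- With `δ` the supremum of a `κ`-sequence closed under `G`, every small set below `δ` lies below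
  -- some `α ξ`.
  obtain ⟨δ, hδ, hmin⟩ := WellFounded.has_min (wellFounded_lt) {δ | ∀ ξ, α ξ < δ} hbd
  refine ⟨δ, fun X hX hXκ => ?_⟩
  have hle : ∀ x : X, ∃ ξ, x.1 ≤ α ξ := by
    intro x
    by_contra! h
    exact hmin x.1 h (hX _ x.2)
  choose b hb using hle
  obtain ⟨ξ, hξ⟩ := exists_forall_lt_of_mk_lt hκ (range b) (mk_range_le.trans_lt hXκ)
  have hXξ : X ⊆ Iio (α ξ) := fun x hx =>
    (hb ⟨x, hx⟩).trans_lt (hα' _ _ (hξ _ ⟨⟨x, hx⟩, rfl⟩)).1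
  have hlt := hG (α ξ) X hXξ hXκ δ
  obtain ⟨ξ', hξ'⟩ := exists_forall_lt_of_mk_lt hκ {ξ} (by
    simpa using one_lt_aleph0.trans_le hκ.aleph0_le)
  exact ⟨next X (T X δ), (hlt.trans (hα' _ _ (hξ' ξ rfl)).2).trans (hδ ξ'),
    hnext X (T X δ) ⟨δ, hX, rfl⟩⟩

/-- Two sets of pairs, regarded as graphs of partial functions, never disagree. -/
def Consistent {I : Type*} (s t : Set (I × Fin 2)) : Prop :=
  ∀ i v w, (i, v) ∈ s → (i, w) ∈ t → v = w

theorem Consistent.symm {I : Type*} {s t : Set (I × Fin 2)} (h : Consistent s t) :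
    Consistent t s := fun i v w hv hw => (h i w v hw hv).symm

theorem Consistent.mono {I : Type*} {s t s' t' : Set (I × Fin 2)} (h : Consistent s t)
    (hs : s' ⊆ s) (ht : t' ⊆ t) : Consistent s' t' :=
  fun i v w hv hw => h i v w (hs hv) (ht hw)

theorem mk_finsets_lt {κ : Cardinal.{u}} (hκ : ℵ₀ ≤ κ) {W : Type u} {X : Set W} (hX : #X < κ) :
    #{a : Finset W | ↑a ⊆ X} < κ := by
  classical
  have h1 : #{a : Finset W | ↑a ⊆ X} ≤ #(Finset X) := by
    refine mk_le_of_surjective (f := fun a : Finset X =>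
      (⟨a.image (↑), by simp⟩ : {a : Finset W | ↑a ⊆ X})) ?_
    rintro ⟨a, ha⟩
    refine ⟨a.subtype (· ∈ X), Subtype.ext ?_⟩
    ext x
    simp only [Finset.mem_image, Finset.mem_subtype, Subtype.exists, exists_and_left, exists_prop,
      exists_eq_right_right]
    exact ⟨fun h => h.1, fun h => ⟨h, ha h⟩⟩
  refine h1.trans_lt ?_
  rcases finite_or_infinite X with hf | hf
  · exact (lt_aleph0_of_finite _).trans_le hκ
  · rwa [mk_finset_of_infinite]

theorem mk_biUnion_lt_of_finite {κ : Cardinal.{u}} (hκ : κ.IsRegular) {A B : Type u} {s : Set A}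
    (hs : #s < κ) (f : A → Set B) (hf : ∀ a ∈ s, (f a).Finite) : #(⋃ a ∈ s, f a) < κ :=
  (card_biUnion_lt_iff_forall_of_isRegular (t := fun a _ => f a) hκ hs).2 fun a ha =>
    ((hf a ha).lt_aleph0).trans_le hκ.aleph0_le

theorem mk_range_le_two_powerlt {κ : Cardinal.{u}} (hκ : κ.IsRegular) {W A B : Type u}
    {S : Set A} {S' : Set B} (hS : #S < κ) (hS' : #S' < κ) (T : W → Set A × Set B)
    (hT : ∀ β, (T β).1 ⊆ S ∧ (T β).2 ⊆ S') : #(range T) ≤ 2 ^< κ := by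
  have hsub : range T ⊆ 𝒫 S ×ˢ 𝒫 S' := by
    rintro _ ⟨β, rfl⟩
    exact hT β
  calc #(range T) ≤ _ := mk_le_mk_of_subset hsub
    _ = 2 ^ (#S + #S') := by rw [mk_setProd]; simp [power_add]
    _ ≤ 2 ^< κ := le_powerlt _ (add_lt_of_lt hκ.aleph0_le hS hS')

/-- An increasing sequence of length `κ` below `(2 ^< κ)⁺` whose members look, over their
predecessors, like a single point `δ`. -/
theorem exists_end_uniform {κ θ : Cardinal.{u}} (hκ : κ.IsRegular)
    (hθ : θ = Order.succ (2 ^< κ)) {I : Type u} (p : Finset θ.ord.ToType → Set (I × Fin 2))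
    (hp : ∀ a, (p a).Finite) (F : Finset θ.ord.ToType → Set I) (hF : ∀ a, (F a).Finite) :
    ∃ (α : κ.ord.ToType → θ.ord.ToType) (δ : θ.ord.ToType) (M : Set I), StrictMono α ∧
      (∀ ξ, α ξ < δ) ∧ ∀ ξ, ∀ a : Finset κ.ord.ToType, (∀ ζ ∈ a, ζ < ξ) →
        (∀ z ∈ p (insert δ (a.image α)), z.1 ∈ M → z ∈ p (insert (α ξ) (a.image α))) ∧
        (∀ c : Finset κ.ord.ToType, (∀ ζ ∈ c, ζ < ξ) → ∀ z ∈ p (insert (α ξ) (a.image α)),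
          z.1 ∈ F (c.image α) → z ∈ p (insert δ (a.image α)) ∧ z.1 ∈ M) ∧
        (∀ b : Finset κ.ord.ToType, (∀ ζ ∈ b, ζ < ξ) →
          Consistent (p (insert δ (a.image α))) (p (insert δ (b.image α))) →
          Consistent (p (insert (α ξ) (a.image α))) (p (insert (α ξ) (b.image α)))) := by
  classical
  let W := θ.ord.ToType
  let Z : Set W → Set I := fun X => ⋃ c ∈ {a : Finset W | ↑a ⊆ X}, F c
  -- The type of `β` over `X` records the conditions on the coordinates captured by `X`, and which
  -- pairs of conditions are consistent.
  let T : Set W → W → Set (Finset W × I × Fin 2) × Set (Finset W × Finset W) := fun X β =>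
    ({t | ↑t.1 ⊆ X ∧ t.2.1 ∈ Z X ∧ t.2 ∈ p (insert β t.1)},
      {t | ↑t.1 ⊆ X ∧ ↑t.2 ⊆ X ∧ Consistent (p (insert β t.1)) (p (insert β t.2))})
  have hZ : ∀ X : Set W, #X < κ → #(Z X) < κ := fun X hX =>
    mk_biUnion_lt_of_finite hκ (mk_finsets_lt hκ.aleph0_le hX) F fun a _ => hF a
  obtain ⟨δ, hδ⟩ := exists_reflecting hκ hθ T (by
    intro X hX
    have hfin := mk_finsets_lt hκ.aleph0_le hX
    refine mk_range_le_two_powerlt hκ (S := {a : Finset W | ↑a ⊆ X} ×ˢ (Z X ×ˢ Set.univ))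
      (S' := {a : Finset W | ↑a ⊆ X} ×ˢ {a : Finset W | ↑a ⊆ X}) ?_ ?_ _ ?_
    · rw [mk_setProd, mk_congr (Equiv.Set.prod (Z X) (Set.univ : Set (Fin 2))), mk_prod]
      simp only [lift_uzero]
      refine mul_lt_of_lt hκ.aleph0_le hfin (mul_lt_of_lt hκ.aleph0_le (hZ X hX) ?_)
      simpa using hκ.nat_lt 2
    · rw [mk_setProd]
      simpa using mul_lt_of_lt hκ.aleph0_le hfin hfin
    · exact fun β => ⟨fun t ht => ⟨ht.1, ht.2.1, trivial⟩, fun t ht => ⟨ht.1, ht.2.1⟩⟩)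
  let M : Set I := {i | ∃ c : Finset W, (∀ x ∈ c, x < δ) ∧ i ∈ F c}
  have hC : ∀ i, ∃ c : Finset W, (∀ x ∈ c, x < δ) ∧ (i ∈ M → i ∈ F c) := by
    intro i
    by_cases hi : i ∈ M
    · obtain ⟨c, hc, hic⟩ := hi
      exact ⟨c, hc, fun _ => hic⟩
    · exact ⟨∅, by simp, fun h => (hi h).elim⟩
  choose C hCδ hCM using hC
  obtain ⟨α, hα⟩ := exists_recursion (κ := κ) (W := W) (· < δ)
    (fun X β => (∀ x ∈ X, x < β) ∧ ∀ a : Finset W, ↑a ⊆ X →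
        (∀ z ∈ p (insert δ a), z.1 ∈ M → z ∈ p (insert β a)) ∧
        (∀ c : Finset W, ↑c ⊆ X → ∀ z ∈ p (insert β a),
          z.1 ∈ F c → z ∈ p (insert δ a) ∧ z.1 ∈ M) ∧
        (∀ b : Finset W, ↑b ⊆ X → Consistent (p (insert δ a)) (p (insert δ b)) →
          Consistent (p (insert β a)) (p (insert β b)))) (by
    intro X hX hXδ
    let E : Set (I × Fin 2) := ⋃ a ∈ {a : Finset W | ↑a ⊆ X}, p (insert δ a)
    have hE : #E < κ := mk_biUnion_lt_of_finite hκ (mk_finsets_lt hκ.aleph0_le hX)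
      (fun a => p (insert δ a)) fun a _ => hp _
    -- A coordinate in `M` of some `p (insert δ a)` may be captured only outside `X`; adding the
    -- witnesses `C` lets the type over `Y` see it.
    let Y : Set W := X ∪ ⋃ z ∈ E, (C z.1 : Set W)
    have hY : #Y < κ := (mk_union_le _ _).trans_lt (add_lt_of_lt hκ.aleph0_le hX
      (mk_biUnion_lt_of_finite hκ hE (fun z => (C z.1 : Set W)) fun z _ => Finset.finite_toSet _))
    have hYδ : ∀ x ∈ Y, x < δ := by
      rintro x (hx | hx)
      · exact hXδ x hx
      · simp only [mem_iUnion] at hx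
        obtain ⟨z, -, hz⟩ := hx
        exact hCδ _ x hz
    obtain ⟨β, hβδ, hβY, hβT⟩ := hδ Y hYδ hY
    have hXY : X ⊆ Y := subset_union_left
    have h1 : ∀ t, t ∈ (T Y β).1 ↔ t ∈ (T Y δ).1 := fun t => by rw [hβT]
    have h2 : ∀ t, t ∈ (T Y β).2 ↔ t ∈ (T Y δ).2 := fun t => by rw [hβT]
    refine ⟨β, hβδ, fun x hx => hβY x (hXY hx), fun a ha => ⟨?_, ?_, ?_⟩⟩
    · intro z hz hzM
      have hzE : z ∈ E := mem_biUnion (show a ∈ {a : Finset W | ↑a ⊆ X} from ha) hz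
      have hzY : (C z.1 : Set W) ⊆ Y := fun x hx => .inr (mem_biUnion hzE hx)
      have hzZ : z.1 ∈ Z Y :=
        mem_biUnion (show C z.1 ∈ {a : Finset W | ↑a ⊆ Y} from hzY) (hCM _ hzM)
      exact ((h1 (a, z)).2 ⟨ha.trans hXY, hzZ, hz⟩).2.2
    · intro c hc z hz hzc
      have hzZ : z.1 ∈ Z Y :=
        mem_biUnion (show c ∈ {a : Finset W | ↑a ⊆ Y} from hc.trans hXY) hzc
      exact ⟨((h1 (a, z)).1 ⟨ha.trans hXY, hzZ, hz⟩).2.2, c, fun x hx => hXδ x (hc hx), hzc⟩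
    · intro b hb hab
      exact ((h2 (a, b)).2 ⟨ha.trans hXY, hb.trans hXY, hab⟩).2.2)
  have him : ∀ ξ, ∀ a : Finset κ.ord.ToType, (∀ ζ ∈ a, ζ < ξ) →
      (↑(a.image α) : Set W) ⊆ α '' Iio ξ := by
    intro ξ a ha
    rw [Finset.coe_image]
    exact image_mono ha
  refine ⟨α, δ, M, fun ζ ξ h => (hα ξ).2.1 _ ⟨ζ, h, rfl⟩, fun ξ => (hα ξ).1, fun ξ a ha => ?_⟩
  obtain ⟨h1, h2, h3⟩ := (hα ξ).2.2 _ (him ξ a ha)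
  exact ⟨h1, fun c hc => h2 _ (him ξ c hc), fun b hb => h3 _ (him ξ b hb)⟩

/-! ### Aligned finite sets and the induction step. -/

/-- Every common element of `a` and `b` has the same number of predecessors in both. -/
def PositionAligned {L : Type*} [LinearOrder L] (a b : Finset L) : Prop :=
  ∀ γ ∈ a, γ ∈ b → (a.filter (· < γ)).card = (b.filter (· < γ)).card

theorem PositionAligned.symm {L : Type*} [LinearOrder L] {a b : Finset L}
    (h : PositionAligned a b) : PositionAligned b a := fun γ hb ha => (h γ ha hb).symm

theorem PositionAligned.of_insert_left {L : Type*} [LinearOrder L] {a b : Finset L} {x : L}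
    (hx : ∀ y ∈ a, y < x) (h : PositionAligned (insert x a) b) : PositionAligned a b := by
  intro γ ha hb
  rw [← h γ (Finset.mem_insert_of_mem ha) hb, Finset.filter_insert, if_neg (hx γ ha).not_gt]

theorem PositionAligned.card_eq {L : Type*} [LinearOrder L] {a b : Finset L} {x : L}
    (ha : ∀ y ∈ a, y < x) (hb : ∀ y ∈ b, y < x)
    (h : PositionAligned (insert x a) (insert x b)) : a.card = b.card := by
  have := h x (Finset.mem_insert_self _ _) (Finset.mem_insert_self _ _)
  rwa [Finset.filter_insert, Finset.filter_insert, if_neg (lt_irrefl x), if_neg (lt_irrefl x),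
    Finset.filter_true_of_mem ha, Finset.filter_true_of_mem hb] at this

theorem exists_eq_insert_max {L : Type*} [LinearOrder L] {a : Finset L} (h : a.Nonempty) :
    ∃ (x : L) (a' : Finset L), (∀ y ∈ a', y < x) ∧ a = insert x a' ∧ a.card = a'.card + 1 := by
  refine ⟨a.max' h, a.erase (a.max' h), fun y hy => a.lt_max'_of_mem_erase_max' h hy,
    (Finset.insert_erase (a.max'_mem h)).symm, ?_⟩
  rw [Finset.card_erase_add_one (a.max'_mem h)]

/-- Every system of finite partial functions indexed by the `n`-element subsets of `θ` has a
subsystem of size `lam` which, together with a system of roots `r a` for shorter `a`,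
is consistent along aligned index sets. The value `r (insert x a)` meets the finite sets `F c`
determined by the predecessors of `x` only inside the root `r a`. -/
def HasRootedSubsystems (lam θ : Cardinal.{u}) (n : ℕ) : Prop :=
  ∀ (I : Type u) (p : Finset θ.ord.ToType → Set (I × Fin 2)) (F : Finset θ.ord.ToType → Set I),
    (∀ a, (p a).Finite) → (∀ a, Consistent (p a) (p a)) → (∀ a, (F a).Finite) →
    ∃ (h : lam.ord.ToType → θ.ord.ToType) (r : Finset lam.ord.ToType → Set (I × Fin 2)),
      StrictMono h ∧
      (∀ a, a.card = n → r a = p (a.image h)) ∧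
      (∀ a x, (∀ y ∈ a, y < x) → a.card < n → r a ⊆ r (insert x a)) ∧
      (∀ a x (c : Finset lam.ord.ToType), (∀ y ∈ a, y < x) → (∀ y ∈ c, y < x) → a.card < n →
        ∀ z ∈ r (insert x a), z.1 ∈ F (c.image h) → z ∈ r a) ∧
      (∀ a b, PositionAligned a b → a.card ≤ n → b.card ≤ n → Consistent (r a) (r b)) ∧
      (∀ a x, (∀ y ∈ a, y < x) → a.card ≤ n →
        ∃ c : Finset θ.ord.ToType, c.card = n ∧ (∀ y ∈ c, y < h x) ∧ r a ⊆ p c)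

theorem HasRootedSubsystems.succ {lam κ θ : Cardinal.{u}} {n : ℕ} (hn : 1 ≤ n)
    (hκ : κ.IsRegular) (hθ : θ = Order.succ (2 ^< κ)) (H : HasRootedSubsystems lam κ n) :
    HasRootedSubsystems lam θ (n + 1) := by
  classical
  intro I p F hp hpc hF
  let F₁ : Finset θ.ord.ToType → Set I := fun c => F c ∪ Prod.fst '' p c
  have hF₁ : ∀ c, (F₁ c).Finite := fun c => (hF c).union ((hp c).image _)
  obtain ⟨α, δ, M, hαm, hαδ, hα⟩ := exists_end_uniform hκ hθ p hp F₁ hF₁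
  -- Any two values of `e` have an index strictly between them; in `hbelow` such an index stands in
  -- for `δ`.
  obtain ⟨e, he⟩ := exists_recursion (κ := κ) (W := κ.ord.ToType) (fun _ => True)
    (fun X b => ∀ x ∈ X, ∃ y, x < y ∧ y < b) (by
      intro X hX _
      obtain ⟨y, hy⟩ := exists_forall_lt_of_mk_lt hκ X hX
      obtain ⟨b, hb⟩ := exists_forall_lt_of_mk_lt hκ {y} (by simpa using hκ.nat_lt 1)
      exact ⟨b, trivial, fun x hx => ⟨y, hy x hx, hb y rfl⟩⟩)
  have hey : ∀ ζ ξ, ζ < ξ → ∃ y, e ζ < y ∧ y < e ξ := fun ζ ξ h => (he ξ).2 _ ⟨ζ, h, rfl⟩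
  have hem : StrictMono e := fun ζ ξ h => by
    obtain ⟨y, h1, h2⟩ := hey ζ ξ h
    exact h1.trans h2
  obtain ⟨g, s, hgm, hs0, hs1, hs2, hs3, hs4⟩ := H I
    (fun a => p (insert δ (a.image (α ∘ e)))) (fun c => F₁ (c.image (α ∘ e)))
    (fun a => hp _) (fun a => hpc _) (fun a => hF₁ _)
  let h : lam.ord.ToType → θ.ord.ToType := fun x => α (e (g x))
  have hhm : StrictMono h := hαm.comp (hem.comp hgm)
  -- The old `s a` may contain coordinates of `p (insert δ _)` that are not captured below `δ`; only
  -- the part over `M` is copied by every later point.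
  let r : Finset lam.ord.ToType → Set (I × Fin 2) := fun a =>
    if a.card ≤ n then {z ∈ s a | z.1 ∈ M} else p (a.image h)
  have hr_le : ∀ a, a.card ≤ n → r a = {z ∈ s a | z.1 ∈ M} := fun a ha => if_pos ha
  have hr_eq : ∀ a, a.card = n + 1 → r a = p (a.image h) := fun a ha => if_neg (by omega)
  have hrs : ∀ a, a.card ≤ n → r a ⊆ s a := fun a ha z hz => by
    rw [hr_le a ha] at hz
    exact hz.1
  have himage : ∀ a : Finset lam.ord.ToType, (a.image (e ∘ g)).image α = a.image h := fun a => by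
    rw [Finset.image_image]; rfl
  have himage' : ∀ a : Finset lam.ord.ToType, (a.image g).image (α ∘ e) = a.image h := fun a => by
    rw [Finset.image_image]; rfl
  have hs0' : ∀ a, a.card = n → s a = p (insert δ (a.image h)) := fun a ha => by
    rw [hs0 a ha, himage']
  have hltx : ∀ (a : Finset lam.ord.ToType) x, (∀ y ∈ a, y < x) →
      ∀ ζ ∈ a.image (e ∘ g), ζ < e (g x) := fun a x hax ζ hζ => by
    obtain ⟨y, hy, rfl⟩ := Finset.mem_image.1 hζ
    exact hem (hgm (hax y hy))
  have hrx : ∀ a x, (∀ y ∈ a, y < x) → a.card = n →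
      r (insert x a) = p (insert (h x) (a.image h)) := fun a x hax ha => by
    rw [hr_eq _ (by rw [Finset.card_insert_of_notMem fun hx => (hax x hx).false, ha]),
      Finset.image_insert]
  have htop1 : ∀ a x, (∀ y ∈ a, y < x) → a.card = n → r a ⊆ r (insert x a) := by
    intro a x hax ha z hz
    rw [hr_le a ha.le, hs0' a ha] at hz
    rw [hrx a x hax ha]
    have := (hα (e (g x)) _ (hltx a x hax)).1 z
    rw [himage] at this
    exact this hz.1 hz.2
  have htop2 : ∀ a x (c : Finset κ.ord.ToType), (∀ y ∈ a, y < x) → (∀ y ∈ c, y < e (g x)) →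
      a.card = n → ∀ z ∈ r (insert x a), z.1 ∈ F₁ (c.image α) → z ∈ r a := by
    intro a x c hax hcx ha z hz hzc
    rw [hrx a x hax ha] at hz
    rw [hr_le a ha.le, hs0' a ha]
    have := (hα (e (g x)) _ (hltx a x hax)).2.1 c hcx z
    rw [himage] at this
    exact this hz hzc
  have hbelow : ∀ a x, (∀ y ∈ a, y < x) → a.card ≤ n → ∃ c : Finset κ.ord.ToType,
      c.card = n + 1 ∧ (∀ y ∈ c, y < e (g x)) ∧ r a ⊆ p (c.image α) := by
    intro a x hax ha
    obtain ⟨c, hcn, hcx, hac⟩ := hs4 a x hax ha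
    have hcne : c.Nonempty := Finset.card_pos.1 (by omega)
    obtain ⟨y, hy, hyx⟩ := hey _ _ (hcx _ (c.max'_mem hcne))
    have hcy : ∀ ζ ∈ c.image e, ζ < y := fun ζ hζ => by
      obtain ⟨w, hw, rfl⟩ := Finset.mem_image.1 hζ
      exact (hem.monotone (c.le_max' w hw)).trans_lt hy
    refine ⟨insert y (c.image e), ?_, ?_, ?_⟩
    · rw [Finset.card_insert_of_notMem fun hmem => (hcy y hmem).false,
        Finset.card_image_of_injective _ hem.injective, hcn]
    · intro w hw
      rcases Finset.mem_insert.1 hw with rfl | hw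
      · exact hyx
      · exact (hcy w hw).trans hyx
    · intro z hz
      rw [hr_le a ha] at hz
      have h1 := hac hz.1
      have h2 := (hα y _ hcy).1 z
      rw [Finset.image_image] at h2
      rw [Finset.image_insert, Finset.image_image]
      exact h2 h1 hz.2
  have hcons_le : ∀ a b, PositionAligned a b → a.card ≤ n → b.card ≤ n →
      Consistent (r a) (r b) := fun a b hab ha hb =>
    (hs3 a b hab ha hb).mono (hrs a ha) (hrs b hb)
  -- The induction is on the size of the shorter set, which loses its top whenever that top is the
  -- larger one.
  have hcons_lt : ∀ a, a.card = n + 1 → ∀ m, ∀ b, b.card = m → PositionAligned a b →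
      b.card ≤ n → Consistent (r a) (r b) := by
    intro a ha m
    obtain ⟨x, a', hax, rfl, hacard⟩ := exists_eq_insert_max (Finset.card_pos.1 (by omega : 0 < a.card))
    have ha' : a'.card = n := by omega
    induction m with
    | zero =>
      intro b hb hab hbn i v w hv hw
      obtain rfl := Finset.card_eq_zero.1 hb
      obtain ⟨c, -, hcx, hbc⟩ := hbelow ∅ x (by simp) (by simp)
      exact hcons_le a' ∅ (hab.of_insert_left hax) ha'.le hbn i v w
        (htop2 a' x c hax hcx ha' _ hv (.inr ⟨_, hbc hw, rfl⟩)) hw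
    | succ m ih =>
      intro b hb hab hbn i v w hv hw
      obtain ⟨y, b', hby, rfl, hbcard⟩ := exists_eq_insert_max (Finset.card_pos.1 (by omega : 0 < b.card))
      rcases lt_trichotomy y x with hyx | rfl | hxy
      · have hbx : ∀ t ∈ insert y b', t < x := by
          intro t ht
          rcases Finset.mem_insert.1 ht with rfl | ht
          · exact hyx
          · exact (hby t ht).trans hyx
        obtain ⟨c, -, hcx, hbc⟩ := hbelow _ x hbx hbn
        exact hcons_le a' _ (hab.of_insert_left hax) ha'.le hbn i v w
          (htop2 a' x c hax hcx ha' _ hv (.inr ⟨_, hbc hw, rfl⟩)) hw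
      -- A common top would have `n` predecessors in one set and fewer in the other.
      · have := PositionAligned.card_eq hax hby hab
        omega
      · have hay : ∀ t ∈ insert x a', t < y := by
          intro t ht
          rcases Finset.mem_insert.1 ht with rfl | ht
          · exact hxy
          · exact (hax t ht).trans hxy
        rw [hr_le _ hbn] at hw
        have h1 := hs2 b' y (insert x a') hby hay (by omega) _ hw.1 (by
          change i ∈ F₁ _
          rw [himage', Finset.image_insert]
          rw [hrx a' x hax ha'] at hv
          exact .inr ⟨_, hv, rfl⟩)
        have h2 : (i, w) ∈ r b' := by
          rw [hr_le b' (by omega)]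
          exact ⟨h1, hw.2⟩
        exact ih b' (by omega) (hab.symm.of_insert_left hby).symm (by omega) i v w hv h2
  have hcons_top : ∀ a' x b' y, (∀ t ∈ a', t < x) → (∀ t ∈ b', t < y) → a'.card = n →
      b'.card = n → PositionAligned (insert x a') (insert y b') → y < x →
      Consistent (r (insert x a')) (r (insert y b')) := by
    intro a' x b' y hax hby ha' hb' hab hyx i v w hv hw
    have hbx : ∀ t ∈ insert y b', t < x := by
      intro t ht
      rcases Finset.mem_insert.1 ht with rfl | ht
      · exact hyx
      · exact (hby t ht).trans hyx
    have h1 := htop2 a' x _ hax (hltx _ x hbx) ha' _ hv (by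
      rw [himage, Finset.image_insert]
      have hw' := hw
      rw [hrx b' y hby hb'] at hw'
      exact .inr ⟨_, hw', rfl⟩)
    exact (hcons_lt (insert y b')
      (by rw [Finset.card_insert_of_notMem fun hy => (hby y hy).false, hb']) _ a' rfl
      (hab.of_insert_left hax).symm ha'.le).symm i v w h1 hw
  refine ⟨h, r, hhm, hr_eq, ?_, ?_, ?_, ?_⟩
  · intro a x hax ha
    rcases (Nat.lt_succ_iff.1 ha).lt_or_eq with ha | ha
    · intro z hz
      rw [hr_le a ha.le] at hz
      rw [hr_le _ (by rw [Finset.card_insert_of_notMem fun hx => (hax x hx).false]; omega)]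
      exact ⟨hs1 a x hax ha hz.1, hz.2⟩
    · exact htop1 a x hax ha
  · intro a x c hax hcx ha z hz hzc
    rcases (Nat.lt_succ_iff.1 ha).lt_or_eq with ha | ha
    · rw [hr_le _ (by rw [Finset.card_insert_of_notMem fun hx => (hax x hx).false]; omega)] at hz
      rw [hr_le a ha.le]
      refine ⟨hs2 a x c hax hcx ha z hz.1 ?_, hz.2⟩
      rw [himage']
      exact .inl hzc
    · refine htop2 a x _ hax (hltx c x hcx) ha z hz ?_
      rw [himage]
      exact .inl hzc
  · intro a b hab ha hb
    rcases ha.lt_or_eq with ha | ha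
    · rcases hb.lt_or_eq with hb | hb
      · exact hcons_le a b hab (by omega) (by omega)
      · exact (hcons_lt b hb _ a rfl hab.symm (by omega)).symm
    rcases hb.lt_or_eq with hb | hb
    · exact hcons_lt a ha _ b rfl hab (by omega)
    obtain ⟨x, a', hax, rfl, hacard⟩ := exists_eq_insert_max (Finset.card_pos.1 (by omega : 0 < a.card))
    obtain ⟨y, b', hby, rfl, hbcard⟩ := exists_eq_insert_max (Finset.card_pos.1 (by omega : 0 < b.card))
    have ha' : a'.card = n := by omega
    have hb' : b'.card = n := by omega
    rcases lt_trichotomy y x with hyx | rfl | hxy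
    · exact hcons_top a' x b' y hax hby ha' hb' hab hyx
    -- With equal tops, end-uniformity transfers consistency from `δ` to `h y`.
    · rw [hrx a' y hax ha', hrx b' y hby hb']
      have h1 := (hα (e (g y)) _ (hltx a' y hax)).2.2 _ (hltx b' y hby)
      rw [himage, himage, ← hs0' a' ha', ← hs0' b' hb'] at h1
      have hab' : PositionAligned a' b' :=
        ((hab.of_insert_left hax).symm.of_insert_left hby).symm
      exact h1 (hs3 a' b' hab' ha'.le hb'.le)
    · exact (hcons_top b' y a' x hby hax hb' ha' hab.symm hxy).symm
  · intro a x hax ha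
    rcases ha.lt_or_eq with ha | ha
    · obtain ⟨c, hcn, hcx, hac⟩ := hbelow a x hax (by omega)
      refine ⟨c.image α, ?_, ?_, hac⟩
      · rw [Finset.card_image_of_injective _ hαm.injective, hcn]
      · intro w hw
        obtain ⟨y, hy, rfl⟩ := Finset.mem_image.1 hw
        exact hαm (hcx y hy)
    · refine ⟨a.image h, ?_, ?_, (hr_eq a ha).subset⟩
      · rw [Finset.card_image_of_injective _ hhm.injective, ha]
      · intro w hw
        obtain ⟨y, hy, rfl⟩ := Finset.mem_image.1 hw
        exact hhm (hax y hy)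

/-! ### The base case: Δ-systems. -/

/-- A Δ-system lemma: a root `R` contained in members arbitrarily far out whose remaining part
avoids any prescribed small set. -/
theorem exists_root {κ : Cardinal.{u}} (hκ : κ.IsRegular) (hκ₀ : ℵ₀ < κ) {I : Type u}
    (p : κ.ord.ToType → Set (I × Fin 2)) (hp : ∀ x, (p x).Finite) :
    ∃ R : Set (I × Fin 2), (∃ y, R ⊆ p y) ∧ ∀ Z : Set I, #Z < κ → ∀ y, ∃ x, y < x ∧ R ⊆ p x ∧
      ∀ z ∈ p x, z.1 ∈ Z → z ∈ R := by
  classical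
  obtain ⟨x₀, -⟩ := exists_forall_lt_of_mk_lt hκ ∅ (by simpa using hκ.pos)
  have : Nonempty κ.ord.ToType := ⟨x₀⟩
  -- Otherwise each size is bounded in `κ`, and the countably many bounds have a common bound
  -- because `κ` is uncountable.
  obtain ⟨m, hm⟩ : ∃ m : ℕ, ∀ y, ∃ x, y < x ∧ (p x).ncard = m := by
    by_contra! hcon
    choose b hb using hcon
    obtain ⟨x, hx⟩ := exists_forall_lt_of_mk_lt hκ (range b)
      (lt_of_le_of_lt (mk_le_aleph0_iff.2 (countable_range b)) hκ₀)
    exact hb (p x).ncard x (hx _ ⟨_, rfl⟩) rfl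
  -- Minimizing `k` makes `R` as large as possible, so each `z` outside `R` lies in only boundedly
  -- many members of size `m` that contain `R`.
  have hex : ∃ k, ∃ R : Set (I × Fin 2), R.Finite ∧ R.ncard + k = m ∧
      ∀ y, ∃ x, y < x ∧ (p x).ncard = m ∧ R ⊆ p x :=
    ⟨m, ∅, finite_empty, by simp, fun y => by simpa using hm y⟩
  obtain ⟨R, hRf, hRm, hR⟩ := Nat.find_spec hex
  have hmax : ∀ z, z ∉ R → ∃ y, ∀ x, y < x → (p x).ncard = m → R ⊆ p x → z ∉ p x := by
    intro z hz
    by_contra! hcon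
    have hcard := ncard_insert_of_notMem hz hRf
    obtain ⟨x, -, hxm, hRx, hzx⟩ := hcon x₀
    have hle : (insert z R).ncard ≤ m := hxm ▸ ncard_le_ncard (insert_subset hzx hRx) (hp x)
    refine Nat.find_min hex (m := Nat.find hex - 1) (by omega)
      ⟨insert z R, hRf.insert z, by omega, fun y => ?_⟩
    obtain ⟨x, h1, h2, h3, h4⟩ := hcon y
    exact ⟨x, h1, h2, insert_subset h4 h3⟩
  choose! b hb using hmax
  refine ⟨R, ?_, fun Z hZ y => ?_⟩
  · obtain ⟨x, -, -, hx⟩ := hR x₀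
    exact ⟨x, hx⟩
  have hZ2 : #(Z ×ˢ (Set.univ : Set (Fin 2)) : Set (I × Fin 2)) < κ := by
    rw [mk_congr (Equiv.Set.prod Z (Set.univ : Set (Fin 2))), mk_prod]
    simp only [lift_uzero]
    refine mul_lt_of_lt hκ.aleph0_le hZ ?_
    simpa using hκ.nat_lt 2
  obtain ⟨y', hy'⟩ := exists_forall_lt_of_mk_lt hκ _ (mk_image_le.trans_lt hZ2 : #(b '' _) < κ)
  obtain ⟨x, hyx, hxm, hRx⟩ := hR (max y y')
  refine ⟨x, (le_max_left _ _).trans_lt hyx, hRx, fun z hz hzZ => ?_⟩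
  by_contra hzR
  exact hb z hzR x ((hy' _ ⟨z, ⟨hzZ, trivial⟩, rfl⟩).trans ((le_max_right _ _).trans_lt hyx))
    hxm hRx hz

theorem hasRootedSubsystems_one {lam : Cardinal.{u}} (hreg : lam.IsRegular) (hunc : ℵ₀ < lam) :
    HasRootedSubsystems lam lam 1 := by
  classical
  intro I p F hp hpc hF
  obtain ⟨R, ⟨y₀, hy₀⟩, hR⟩ := exists_root hreg hunc (fun x => p {x}) (fun x => hp _)
  -- Staying above `y₀` puts a condition containing the root, `p {y₀}`, below every chosen point.
  obtain ⟨α, hα⟩ := exists_recursion (κ := lam) (W := lam.ord.ToType) (fun _ => True)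
    (fun X β => (∀ x ∈ X, x < β) ∧ y₀ < β ∧ R ⊆ p {β} ∧ ∀ c : Finset lam.ord.ToType, ↑c ⊆ X →
      ∀ z ∈ p {β}, z.1 ∈ F c ∪ Prod.fst '' p c → z ∈ R) (by
    intro X hX _
    obtain ⟨y, hy⟩ := exists_forall_lt_of_mk_lt hreg X hX
    let F' : Finset lam.ord.ToType → Set I := fun c => F c ∪ Prod.fst '' p c
    have hZ : #(⋃ c ∈ {c : Finset lam.ord.ToType | ↑c ⊆ X}, F' c) < lam :=
      mk_biUnion_lt_of_finite hreg (mk_finsets_lt hreg.aleph0_le hX) F'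
        fun c _ => (hF c).union ((hp c).image _)
    obtain ⟨x, hyx, hRx, hx⟩ := hR _ hZ (max y y₀)
    refine ⟨x, trivial, fun w hw => (hy w hw).trans ((le_max_left _ _).trans_lt hyx),
      (le_max_right _ _).trans_lt hyx, hRx, fun c hc z hz hzc => hx z hz ?_⟩
    exact mem_biUnion (show c ∈ {c : Finset lam.ord.ToType | ↑c ⊆ X} from hc) hzc)
  have hαm : StrictMono α := fun ζ ξ h => (hα ξ).2.1 _ ⟨ζ, h, rfl⟩
  have hαR : ∀ x, R ⊆ p {α x} := fun x => (hα x).2.2.2.1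
  have hαF : ∀ x, ∀ c : Finset lam.ord.ToType, (∀ y ∈ c, y < x) → ∀ z ∈ p {α x},
      z.1 ∈ F (c.image α) ∪ Prod.fst '' p (c.image α) → z ∈ R := fun x c hc =>
    (hα x).2.2.2.2 _ (by
      rw [Finset.coe_image]
      exact image_mono hc)
  let r : Finset lam.ord.ToType → Set (I × Fin 2) := fun a => if a = ∅ then R else p (a.image α)
  have hr0 : r ∅ = R := if_pos rfl
  have hr1 : ∀ x, r {x} = p {α x} := fun x => by
    rw [← Finset.image_singleton]
    exact if_neg (Finset.singleton_ne_empty x)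
  have hlt : ∀ x y, y < x → Consistent (r {x}) (r {y}) := by
    intro x y hyx i v w hv hw
    rw [hr1] at hv hw
    have := hαF x {y} (by simpa using hyx) _ hv (.inr ⟨(i, w), by simpa using hw, rfl⟩)
    exact hpc _ i v w (hαR y this) hw
  have h01 : ∀ x, Consistent (r ∅) (r {x}) := fun x => by
    rw [hr0, hr1]
    exact (hpc _).mono (hαR x) subset_rfl
  refine ⟨α, r, hαm, ?_, ?_, ?_, ?_, ?_⟩
  · intro a ha
    obtain ⟨x, rfl⟩ := Finset.card_eq_one.1 ha
    exact if_neg (Finset.singleton_ne_empty x)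
  · intro a x hax ha
    obtain rfl := Finset.card_eq_zero.1 (Nat.lt_one_iff.1 ha)
    rw [insert_empty_eq, hr0, hr1]
    exact hαR x
  · intro a x c hax hcx ha z hz hzc
    obtain rfl := Finset.card_eq_zero.1 (Nat.lt_one_iff.1 ha)
    rw [insert_empty_eq, hr1] at hz
    rw [hr0]
    exact hαF x c hcx z hz (.inl hzc)
  · intro a b hab ha hb
    rcases Finset.eq_empty_or_nonempty a with rfl | ha'
    · rcases Finset.eq_empty_or_nonempty b with rfl | hb'
      · rw [hr0]
        exact (hpc _).mono hy₀ hy₀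
      · obtain ⟨y, rfl⟩ := Finset.card_eq_one.1 (hb.antisymm (Finset.card_pos.2 hb'))
        exact h01 y
    obtain ⟨x, rfl⟩ := Finset.card_eq_one.1 (ha.antisymm (Finset.card_pos.2 ha'))
    rcases Finset.eq_empty_or_nonempty b with rfl | hb'
    · exact (h01 x).symm
    obtain ⟨y, rfl⟩ := Finset.card_eq_one.1 (hb.antisymm (Finset.card_pos.2 hb'))
    rcases lt_trichotomy y x with hyx | rfl | hxy
    · exact hlt x y hyx
    · rw [hr1]
      exact hpc _
    · exact (hlt y x hxy).symm
  · intro a x hax ha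
    rcases Finset.eq_empty_or_nonempty a with rfl | ha'
    · exact ⟨{y₀}, rfl, by simpa using (hα x).2.2.1, hr0 ▸ hy₀⟩
    obtain ⟨y, rfl⟩ := Finset.card_eq_one.1 (ha.antisymm (Finset.card_pos.2 ha'))
    exact ⟨{α y}, rfl, by simpa using hαm (hax y (Finset.mem_singleton_self y)), (hr1 y).subset⟩

/-! ### The induction and its translation to Cohen conditions. -/

theorem sigma_isRegular {lam : Cardinal.{u}} (hreg : lam.IsRegular) :
    ∀ n, (sigma lam n).IsRegular
  | 0 => hreg
  | 1 => hreg
  | n + 2 => isRegular_succ ((sigma_isRegular hreg (n + 1)).aleph0_le.trans (le_two_powerlt _))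

theorem hasRootedSubsystems_sigma {lam : Cardinal.{u}} (hreg : lam.IsRegular) (hunc : ℵ₀ < lam)
    {n : ℕ} (hn : 1 ≤ n) : HasRootedSubsystems lam (sigma lam n) n := by
  induction n, hn using Nat.le_induction with
  | base => exact hasRootedSubsystems_one hreg hunc
  | succ n hn ih =>
    obtain ⟨m, rfl⟩ := Nat.exists_eq_add_of_le' hn
    exact ih.succ hn (sigma_isRegular hreg _) rfl

theorem compatible_of_forall_eq {I : Type*} {p q : Cohen I}
    (h : ∀ i, ∀ v ∈ p.toPFun i, ∀ w ∈ q.toPFun i, v = w) : Compatible p q := by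
  classical
  refine ⟨⟨fun i => ⟨(p.toPFun i).Dom ∨ (q.toPFun i).Dom, fun hd =>
    if hp : (p.toPFun i).Dom then (p.toPFun i).get hp else (q.toPFun i).get (hd.resolve_left hp)⟩,
    p.finite_dom.union q.finite_dom⟩, ?_, ?_⟩
  · rintro i v ⟨hd, rfl⟩
    exact ⟨.inl hd, dif_pos hd⟩
  · rintro i w ⟨hd, rfl⟩
    refine ⟨.inr hd, ?_⟩
    by_cases hp : (p.toPFun i).Dom
    · exact (dif_pos hp).trans (h i _ ⟨hp, rfl⟩ _ ⟨hd, rfl⟩)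
    · exact dif_neg hp

/-- Initial segments of equal order type have equal cardinality, and here they are finite. -/
theorem Aligned.positionAligned {L : Type u} [LinearOrder L] {f : L → Ordinal.{u}}
    (hf : StrictMono f) {A B : Finset L}
    (h : Aligned (A.image f : Set Ordinal.{u}) (B.image f : Set Ordinal.{u})) :
    PositionAligned A B := by
  classical
  intro γ hA hB
  have hcut : ∀ C : Finset L, ((C.image f : Finset Ordinal.{u}) : Set Ordinal.{u}) ∩ Iio (f γ) =
      ((C.filter (· < γ)).image f : Finset Ordinal.{u}) := by
    intro C
    ext o
    simp only [mem_inter_iff, Finset.mem_coe, Finset.mem_image, mem_Iio, Finset.mem_filter]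
    constructor
    · rintro ⟨⟨x, hx, rfl⟩, hlt⟩
      exact ⟨x, ⟨hx, hf.lt_iff_lt.1 hlt⟩, rfl⟩
    · rintro ⟨x, ⟨hx, hlt⟩, rfl⟩
      exact ⟨⟨x, hx, rfl⟩, hf hlt⟩
  have h1 := congrArg Ordinal.card (h.2 (f γ)
    ⟨Finset.mem_coe.2 (Finset.mem_image_of_mem f hA), Finset.mem_coe.2 (Finset.mem_image_of_mem f hB)⟩)
  rw [hcut, hcut] at h1
  simp only [otp, Ordinal.card_type] at h1
  have h2 : (((A.filter (· < γ)).image f).card : Cardinal.{u + 1}) =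
      ((B.filter (· < γ)).image f).card := by
    rw [← mk_coe_finset, ← mk_coe_finset]
    exact h1
  rw [Finset.card_image_of_injective _ hf.injective,
    Finset.card_image_of_injective _ hf.injective] at h2
  exact_mod_cast h2

end HigherKnaster

theorem lemma4p2 (lam chi mu : Cardinal.{u}) (n : ℕ)
    (hreg : lam.IsRegular) (hunc : Cardinal.aleph0 < lam) (hn : 1 ≤ n)
    (hmu : mu = HigherKnaster.sigma lam n) (hchi : Cardinal.aleph0 ≤ chi)
    (p : HigherKnaster.nSubsets (Set.Iio mu.ord) n → HigherKnaster.Cohen (Set.Iio chi.ord)) :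
    ∃ H : Set Ordinal.{u}, H ⊆ Set.Iio mu.ord ∧
      Cardinal.mk H = Cardinal.lift.{u + 1} lam ∧
      ∀ a b : HigherKnaster.nSubsets (Set.Iio mu.ord) n,
        a.1 ∈ HigherKnaster.nSubsets H n → b.1 ∈ HigherKnaster.nSubsets H n →
        HigherKnaster.Aligned (a.1 : Set Ordinal.{u}) (b.1 : Set Ordinal.{u}) →
        HigherKnaster.Compatible (p a) (p b) := by
  classical
  have hsub : HigherKnaster.HasRootedSubsystems lam mu n :=
    hmu ▸ HigherKnaster.hasRootedSubsystems_sigma hreg hunc hn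
  let f : mu.ord.ToType → Ordinal.{u} := fun x => (Ordinal.ToType.mk.symm x).1
  have hf : StrictMono f := fun x y hxy => Ordinal.ToType.mk.symm.strictMono hxy
  have hfmu : ∀ x, f x < mu.ord := fun x => (Ordinal.ToType.mk.symm x).2
  have hmem : ∀ c : Finset mu.ord.ToType, c.card = n →
      c.image f ∈ HigherKnaster.nSubsets (Set.Iio mu.ord) n := by
    refine fun c hc => ⟨fun o ho => ?_, by rw [Finset.card_image_of_injective _ hf.injective, hc]⟩
    obtain ⟨x, -, rfl⟩ := Finset.mem_image.1 (Finset.mem_coe.1 ho)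
    exact hfmu x
  -- Index sets of the wrong size receive the empty graph.
  let P : Finset mu.ord.ToType → Set (chi.ord.ToType × Fin 2) := fun c =>
    {z | ∃ hc : c.card = n, z.2 ∈ (p ⟨c.image f, hmem c hc⟩).toPFun (Ordinal.ToType.mk.symm z.1)}
  have hPfin : ∀ c, (P c).Finite := by
    intro c
    by_cases hc : c.card = n
    · refine (((p ⟨c.image f, hmem c hc⟩).finite_dom.image Ordinal.ToType.mk).prod
        (Set.finite_univ : (Set.univ : Set (Fin 2)).Finite)).subset ?_
      rintro z ⟨_, hz⟩
      exact ⟨⟨Ordinal.ToType.mk.symm z.1, (PFun.mem_dom _ _).2 ⟨_, hz⟩, by simp⟩, trivial⟩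
    · exact Set.finite_empty.subset fun z hz => hc hz.1
  -- The sets `F c` serve only the induction, so they are taken empty.
  obtain ⟨h, r, hhm, hr, -, -, hcons, -⟩ :=
    hsub chi.ord.ToType P (fun _ => ∅) hPfin
      (fun c i v w hv hw => Part.mem_unique hv.2 hw.2) (fun _ => Set.finite_empty)
  have hg : StrictMono (f ∘ h) := hf.comp hhm
  refine ⟨Set.range (f ∘ h), ?_, ?_, ?_⟩
  · rintro _ ⟨x, rfl⟩
    exact hfmu _
  · have := Cardinal.mk_range_eq_of_injective hg.injective
    rw [Cardinal.lift_id'.{u, u + 1}] at this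
    simpa using this
  · rintro ⟨a, ha⟩ ⟨b, hb⟩ ⟨haH, han⟩ ⟨hbH, hbn⟩ hab
    have hpre : ∀ c : Finset Ordinal.{u}, (c : Set Ordinal.{u}) ⊆ Set.range (f ∘ h) →
        ∃ C : Finset lam.ord.ToType, C.image (f ∘ h) = c := by
      intro c hc
      rw [← Set.image_univ] at hc
      obtain ⟨C, -, hC⟩ := Finset.subset_set_image_iff.1 hc
      exact ⟨C, hC⟩
    obtain ⟨A, rfl⟩ := hpre a haH
    obtain ⟨B, rfl⟩ := hpre b hbH
    have hA : A.card = n := by rwa [Finset.card_image_of_injective _ hg.injective] at han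
    have hB : B.card = n := by rwa [Finset.card_image_of_injective _ hg.injective] at hbn
    have hc := hcons A B (HigherKnaster.Aligned.positionAligned hg hab) hA.le hB.le
    rw [hr A hA, hr B hB] at hc
    refine HigherKnaster.compatible_of_forall_eq fun i v hv w hw =>
      hc (Ordinal.ToType.mk i) v w ⟨?_, ?_⟩ ⟨?_, ?_⟩
    · rw [Finset.card_image_of_injective _ hhm.injective, hA]
    · simpa only [Finset.image_image, OrderIso.symm_apply_apply] using hv
    · rw [Finset.card_image_of_injective _ hhm.injective, hB]
    · simpa only [Finset.image_image, OrderIso.symm_apply_apply] using hw
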